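/- Let $n\ge 1$ and let $\mathrm{Dyck}_n$ be the Dyck (Stanley) lattice: the set of Dyck paths of semilength $n$, ordered by $p\le q$ if $p$ lies weakly below $q$. For an element $a$ of a finite lattice $L$, a join representation of $a$ is a set of join-irreducible elements whose join is $a$. A set $A$ refines a set $B$ if every element of $A$ lies below some element of $B$, and the canonical join representation of $a$, if it exists, is the irredundant join representation of $a$ that refines every join representation of $a$. The canonical join complex $\Delta_L$ is the simplicial complex whose faces are the canonical join representations of the elements of $L$. For a finite simplicial complex $\Delta$ with $f_i(\Delta)$ faces of dimension $i$, put $\tilde\chi(\Delta)=\sum_{i\ge 0}(-1)^i f_i(\Delta)-1$. Then the reduced Euler characteristic of the canonical join complex of the Dyck lattice is either zero or a signed Catalan number; precisely, $$\tilde\chi(\Delta_{\mathrm{Dyck}_n})=\begin{cases}0 & \text{if } n \text{ is even},\\ (-1)^{m+1}C_m & \text{if } n=2m+1,\end{cases}\qquad\text{where } C_m=\frac{1}{m+1}\binom{2m}{m}.$$ -/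

import Mathlib

/-! ### Euler characteristic of a finite simplicial complex -/

namespace PreAbstractSimplicialComplex

variable {V : Type*} (K : PreAbstractSimplicialComplex V)

/-- The number `f_i` of faces of dimension `i`, i.e. of faces with `i + 1` vertices. -/
noncomputable def faceCount (i : ℕ) : ℕ :=
  {s : Finset V | s ∈ K.faces ∧ s.card = i + 1}.ncard

/-- The Euler characteristic `∑_{i ≥ 0} (-1)^i f_i` of a complex on a finite ground set `V`
(every face has dimension less than `|V|`). -/
noncomputable def eulerCharacteristic [Finite V] : ℤ :=
  ∑ i ∈ Finset.range (Nat.card V), (-1) ^ i * (K.faceCount i : ℤ)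

/-- The reduced Euler characteristic. -/
noncomputable def reducedEulerCharacteristic [Finite V] : ℤ :=
  K.eulerCharacteristic - 1

end PreAbstractSimplicialComplex

/-! ### Canonical join representations and the canonical join complex -/

section CanonicalJoin

variable {L : Type*} [Lattice L]

/-- `A` is a join representation of `a`: a set of join-irreducible elements with join `a`.
(The join of the empty set is the least element.) -/
def IsJoinRep (A : Finset L) (a : L) : Prop :=
  (∀ j ∈ A, SupIrred j) ∧ IsLUB (A : Set L) a

/-- `A` refines `B`: every element of `A` lies below some element of `B`. -/
def JoinRefines (A B : Finset L) : Prop :=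
  ∀ x ∈ A, ∃ y ∈ B, x ≤ y

/-- `A` is the canonical join representation of `a`: it is an irredundant join representation
that is minimal for refinement, i.e. it refines every join representation of `a`. -/
structure IsCanonicalJoinRep (A : Finset L) (a : L) : Prop where
  isJoinRep : IsJoinRep A a
  irredundant : ∀ B, B ⊂ A → ¬ IsLUB (B : Set L) a
  refines : ∀ B, IsJoinRep B a → JoinRefines A B

/-- A nonempty subset of a canonical join representation is one as well. -/
theorem IsCanonicalJoinRep.subset {A B : Finset L} {a : L} (h : IsCanonicalJoinRep A a)
    (hBA : B ⊆ A) (hB : B.Nonempty) : ∃ b, IsCanonicalJoinRep B b := by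
  classical
  have key : ∀ C : Finset L, IsLUB (C : Set L) (B.sup' hB id) →
      IsLUB ((C ∪ (A \ B) : Finset L) : Set L) a := by
    intro C hC
    have hBl : IsLUB (B : Set L) (B.sup' hB id) := Finset.isLUB_sup' hB
    refine ⟨fun x hx => ?_, fun u hu => h.isJoinRep.2.2 fun x hx => ?_⟩
    · rcases Finset.mem_union.1 (Finset.mem_coe.1 hx) with hx | hx
      · exact (hC.1 (Finset.mem_coe.2 hx)).trans
          (hBl.2 fun y hy => h.isJoinRep.2.1 (Finset.mem_coe.2 (hBA (Finset.mem_coe.1 hy))))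
      · exact h.isJoinRep.2.1 (Finset.mem_coe.2 (Finset.mem_sdiff.1 hx).1)
    · by_cases hxB : x ∈ B
      · refine (hBl.1 (Finset.mem_coe.2 hxB)).trans (hC.2 fun y hy => hu ?_)
        exact Finset.mem_coe.2 (Finset.mem_union_left _ (Finset.mem_coe.1 hy))
      · exact hu (Finset.mem_coe.2 (Finset.mem_union_right _
          (Finset.mem_sdiff.2 ⟨Finset.mem_coe.1 hx, hxB⟩)))
  have anti : ∀ x ∈ A, ∀ y ∈ A, x ≤ y → x = y := by
    intro x hx y hy hxy
    by_contra hne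
    refine h.irredundant (A.erase x) (Finset.erase_ssubset hx) ⟨fun z hz => ?_, fun u hu => ?_⟩
    · exact h.isJoinRep.2.1 (Finset.mem_coe.2 (Finset.mem_of_mem_erase (Finset.mem_coe.1 hz)))
    · refine h.isJoinRep.2.2 fun z hz => ?_
      by_cases hzx : z = x
      · subst hzx
        exact hxy.trans (hu (Finset.mem_coe.2 (Finset.mem_erase.2 ⟨Ne.symm hne, hy⟩)))
      · exact hu (Finset.mem_coe.2 (Finset.mem_erase.2 ⟨hzx, Finset.mem_coe.1 hz⟩))
  refine ⟨B.sup' hB id, ⟨fun j hj => h.isJoinRep.1 j (hBA hj), Finset.isLUB_sup' hB⟩, ?_, ?_⟩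
  · intro C hC hCl
    refine h.irredundant (C ∪ (A \ B)) ?_ (key C hCl)
    obtain ⟨x, hxB, hxC⟩ := (Finset.ssubset_iff_of_subset hC.1).1 hC
    refine (Finset.ssubset_iff_of_subset (Finset.union_subset (hC.1.trans hBA)
      Finset.sdiff_subset)).2 ⟨x, hBA hxB, ?_⟩
    simp [hxC, hxB]
  · intro C hC x hx
    have hrep : IsJoinRep (C ∪ (A \ B)) a := by
      refine ⟨fun j hj => ?_, key C hC.2⟩
      rcases Finset.mem_union.1 hj with hj | hj
      · exact hC.1 j hj
      · exact h.isJoinRep.1 j (Finset.mem_sdiff.1 hj).1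
    obtain ⟨y, hy, hxy⟩ := h.refines _ hrep x (hBA hx)
    rcases Finset.mem_union.1 hy with hy | hy
    · exact ⟨y, hy, hxy⟩
    · have := anti x (hBA hx) y (Finset.mem_sdiff.1 hy).1 hxy
      exact absurd (this ▸ hx) (Finset.mem_sdiff.1 hy).2

variable (L) in
/-- The canonical join complex of `L`: its faces are the canonical join representations of the
elements of `L`. (Mathlib's convention leaves out the empty face, which is the canonical join
representation of the least element.) -/
def canonicalJoinComplex : PreAbstractSimplicialComplex L where
  faces := {A | A.Nonempty ∧ ∃ a, IsCanonicalJoinRep A a}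
  isRelLowerSet_faces := fun _ hA =>
    ⟨hA.1, fun _ hBA hB => ⟨hB, hA.2.elim fun _ h => h.subset hBA hB⟩⟩

end CanonicalJoin

/-! ### The Dyck lattice (Stanley lattice) -/

/-- Dyck paths of semilength `n`. -/
def DyckPath (n : ℕ) : Type := {p : DyckWord // p.semilength = n}

namespace DyckPath

variable {n : ℕ}

instance : Finite (DyckPath n) :=
  inferInstanceAs (Finite {p : DyckWord // p.semilength = n})

/-- The number of up steps among the first `i` steps of `p`. For `i ≤ 2 * n` the height of `p`
after `i` steps is `2 * p.ups i - i`. -/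
def ups (p : DyckPath n) (i : ℕ) : ℕ := (p.1.toList.take i).count DyckStep.U

theorem length_eq (p : DyckPath n) : p.1.toList.length = 2 * n := by
  rw [← DyckWord.two_mul_semilength_eq_length, p.2]

theorem ext_ups {p q : DyckPath n} (h : ∀ i, p.ups i = q.ups i) : p = q := by
  refine Subtype.ext (DyckWord.ext (List.ext_getElem (by rw [length_eq, length_eq]) ?_))
  intro i h1 h2
  have ha := h i
  have hb := h (i + 1)
  simp only [ups, ← List.take_concat_get' _ _ h1, ← List.take_concat_get' _ _ h2,
    List.count_append, List.count_singleton] at ha hb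
  rcases DyckStep.dichotomy (p.1.toList[i]) with hp | hp <;>
  rcases DyckStep.dichotomy (q.1.toList[i]) with hq | hq <;>
  simp_all

/-- `p ≤ q` if the path `p` lies weakly below the path `q`. -/
instance : PartialOrder (DyckPath n) where
  le p q := ∀ i, p.ups i ≤ q.ups i
  le_refl _ _ := le_rfl
  le_trans _ _ _ h h' i := (h i).trans (h' i)
  le_antisymm _ _ h h' := ext_ups fun i => le_antisymm (h i) (h' i)

theorem le_def {p q : DyckPath n} : p ≤ q ↔ ∀ i, p.ups i ≤ q.ups i := Iff.rfl

theorem ups_zero (p : DyckPath n) : p.ups 0 = 0 := by simp [ups]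

theorem ups_succ (p : DyckPath n) (i : ℕ) : p.ups (i + 1) = p.ups i ∨
    p.ups (i + 1) = p.ups i + 1 := by
  by_cases hi : i < p.1.toList.length
  · simp only [ups, ← List.take_concat_get' _ _ hi, List.count_append, List.count_singleton]
    split_ifs <;> simp
  · left
    simp only [ups]
    rw [List.take_of_length_le (by omega), List.take_of_length_le (by omega)]

theorem ups_of_le (p : DyckPath n) {i : ℕ} (hi : 2 * n ≤ i) : p.ups i = n := by
  rw [ups, List.take_of_length_le (by rw [length_eq]; exact hi)]
  exact p.2

theorem count_add_count (l : List DyckStep) :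
    l.count DyckStep.U + l.count DyckStep.D = l.length := by
  induction l with
  | nil => rfl
  | cons a l ih => cases a <;> simp <;> omega

theorem le_two_mul_ups (p : DyckPath n) {i : ℕ} (hi : i ≤ 2 * n) : i ≤ 2 * p.ups i := by
  have h1 := p.1.count_D_le_count_U i
  have h2 := count_add_count (p.1.toList.take i)
  rw [List.length_take, length_eq, min_eq_left hi] at h2
  simp only [ups]
  omega

/-- A function with the properties of `ups` is realized by a Dyck path. -/
theorem exists_ups_eq (f : ℕ → ℕ) (h0 : f 0 = 0)
    (hs : ∀ i, f (i + 1) = f i ∨ f (i + 1) = f i + 1) (hn : ∀ i, 2 * n ≤ i → f i = n)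
    (hf : ∀ i, i ≤ 2 * n → i ≤ 2 * f i) : ∃ p : DyckPath n, ∀ i, p.ups i = f i := by
  classical
  let g : ℕ → DyckStep := fun i => if f (i + 1) = f i then DyckStep.D else DyckStep.U
  have hg : ∀ k, ((List.range k).map g).count DyckStep.U = f k := by
    intro k
    induction k with
    | zero => simp [h0]
    | succ k ih =>
      rw [List.range_succ, List.map_append, List.count_append, ih]
      rcases hs k with h | h <;> simp [g, h]
  have ht : ∀ i, ((List.range (2 * n)).map g).take i =
      (List.range (min i (2 * n))).map g := by
    intro i
    rw [← List.map_take, List.take_range]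
  have hU : ∀ i, (((List.range (2 * n)).map g).take i).count DyckStep.U = f i := by
    intro i
    rw [ht, hg]
    rcases le_total i (2 * n) with h | h
    · rw [min_eq_left h]
    · rw [min_eq_right h, hn _ le_rfl, hn _ h]
  have hfull : ((List.range (2 * n)).map g).count DyckStep.U = n := by
    rw [hg, hn _ le_rfl]
  refine ⟨⟨⟨(List.range (2 * n)).map g, ?_, ?_⟩, hfull⟩, hU⟩
  · have := count_add_count ((List.range (2 * n)).map g)
    rw [hfull, List.length_map, List.length_range] at this
    omega
  · intro i
    have h1 := count_add_count (((List.range (2 * n)).map g).take i)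
    rw [hU, List.length_take, List.length_map, List.length_range] at h1
    rw [hU]
    rcases le_total i (2 * n) with h | h
    · rw [min_eq_left h] at h1
      have := hf i h
      omega
    · rw [min_eq_right h] at h1
      have := hn i h
      omega

theorem exists_sup (p q : DyckPath n) : ∃ r : DyckPath n, ∀ i, r.ups i = max (p.ups i) (q.ups i) := by
  apply exists_ups_eq
  · simp [ups_zero]
  · intro i
    have h1 := p.ups_succ i
    have h2 := q.ups_succ i
    omega
  · intro i hi
    simp [ups_of_le _ hi]
  · intro i hi
    have h1 := p.le_two_mul_ups hi
    omega

theorem exists_inf (p q : DyckPath n) : ∃ r : DyckPath n, ∀ i, r.ups i = min (p.ups i) (q.ups i) := by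
  apply exists_ups_eq
  · simp [ups_zero]
  · intro i
    have h1 := p.ups_succ i
    have h2 := q.ups_succ i
    omega
  · intro i hi
    simp [ups_of_le _ hi]
  · intro i hi
    have h1 := p.le_two_mul_ups hi
    have h2 := q.le_two_mul_ups hi
    omega

/-- The Dyck lattice (Stanley lattice) of semilength `n`: joins and meets are the upper and lower
envelopes of paths. -/
noncomputable instance : Lattice (DyckPath n) where
  sup p q := (exists_sup p q).choose
  inf p q := (exists_inf p q).choose
  le_sup_left p q i := by
    rw [(exists_sup p q).choose_spec i]; exact le_max_left _ _
  le_sup_right p q i := by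
    rw [(exists_sup p q).choose_spec i]; exact le_max_right _ _
  sup_le p q r h h' i := by
    rw [(exists_sup p q).choose_spec i]; exact max_le (h i) (h' i)
  inf_le_left p q i := by
    rw [(exists_inf p q).choose_spec i]; exact min_le_left _ _
  inf_le_right p q i := by
    rw [(exists_inf p q).choose_spec i]; exact min_le_right _ _
  le_inf r p q h h' i := by
    rw [(exists_inf p q).choose_spec i]; exact le_min (h i) (h' i)

end DyckPath

/-! ### Signed enumeration of Dyck words by peaks -/

/-! Joins of Dyck paths are pointwise maxima of `ups`, so a least path through a given point is
join-prime. Flipping a peak of `p` of height at least two gives the largest path below `p` that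
misses its apex. Hence any join representation of `p` contains an element through each such apex,
and the least paths through these apexes form the canonical join representation
(`isCanonicalJoinRep_canonicalJoinands`). Peaks of height one cannot be flipped and do not count.

Faces, with the empty one included, thus correspond to paths, and the reduced Euler characteristic
is `-∑ (-1) ^ k`, where `k` is the number of peaks of height at least two. Let `H` be the generating
function of this signed sum and `P` its analogue for all peaks. First-return decomposition gives `H
= 1 + X P H` and `P = 1 + X (P - 2) P`. With `D = C(-X²)`, so that `D = 1 - X² D²`, the solutions
are `P = 1 - X D` and `H = 1 + X D`, whose coefficients are the signed Catalan numbers in odd degree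
and zero in positive even degree. -/

namespace DyckWord

/-- The number of up steps among the first `i` steps of `w`. -/
def upCount (w : DyckWord) (i : ℕ) : ℕ := (w.toList.take i).count DyckStep.U

/-- The steps `i` and `i + 1` of `w` form a peak of height at least `t`. -/
def IsPeak (t : ℕ) (w : DyckWord) (i : ℕ) : Prop :=
  w.upCount (i + 1) = w.upCount i + 1 ∧ w.upCount (i + 2) = w.upCount (i + 1) ∧
    i + 1 + t ≤ 2 * w.upCount (i + 1)

instance (t : ℕ) (w : DyckWord) : DecidablePred (w.IsPeak t) := fun _ =>
  inferInstanceAs (Decidable (_ ∧ _ ∧ _))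

/-- The finite set of (indices of) peaks of height at least `t`. -/
def peaks (t : ℕ) (w : DyckWord) : Finset ℕ :=
  (Finset.range (2 * w.semilength)).filter (w.IsPeak t)

theorem upCount_zero (w : DyckWord) : w.upCount 0 = 0 := by simp [upCount]

theorem upCount_of_le (w : DyckWord) {i : ℕ} (h : 2 * w.semilength ≤ i) :
    w.upCount i = w.semilength :=
  DyckPath.ups_of_le (⟨w, rfl⟩ : DyckPath w.semilength) h

theorem le_two_mul_upCount (w : DyckWord) {i : ℕ} (h : i ≤ 2 * w.semilength) :
    i ≤ 2 * w.upCount i :=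
  DyckPath.le_two_mul_ups (⟨w, rfl⟩ : DyckPath w.semilength) h

theorem upCount_le (w : DyckWord) (i : ℕ) : w.upCount i ≤ w.semilength :=
  (List.take_sublist _ _).count_le _

/-! ### Peaks under the first-return decomposition -/

section NestAdd

variable (p q : DyckWord)

theorem toList_nest_add : (p.nest + q).toList =
    DyckStep.U :: (p.toList ++ (DyckStep.D :: q.toList)) := by
  change (DyckStep.U :: p.toList ++ [DyckStep.D]) ++ q.toList = _
  simp

theorem upCount_nest_add_succ {i : ℕ} (h : i ≤ 2 * p.semilength) :
    (p.nest + q).upCount (i + 1) = p.upCount i + 1 := by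
  rw [two_mul_semilength_eq_length] at h
  rw [upCount, toList_nest_add, List.take_succ_cons, List.take_append_of_le_length h]
  simp [upCount]

theorem upCount_nest_add_add (i : ℕ) :
    (p.nest + q).upCount (2 * p.semilength + 2 + i) = p.semilength + 1 + q.upCount i := by
  rw [upCount, toList_nest_add, two_mul_semilength_eq_length,
    show p.toList.length + 2 + i = (p.toList.length + (i + 1)) + 1 by omega,
    List.take_succ_cons, List.take_length_add_append, List.take_succ_cons]
  simp [upCount, semilength]
  omega

theorem card_peaks_eq_sum (t : ℕ) (w : DyckWord) :
    (w.peaks t).card = ∑ i ∈ Finset.range (2 * w.semilength), if w.IsPeak t i then 1 else 0 := by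
  rw [peaks, Finset.card_filter]

theorem isPeak_nest_add_succ (t : ℕ) {i : ℕ} (h : i < 2 * p.semilength) :
    (p.nest + q).IsPeak (t + 1) (i + 1) ↔ p.IsPeak t i := by
  have h1 := upCount_nest_add_succ p q h.le
  have h2 := upCount_nest_add_succ p q (i := i + 1) h
  change (_ ∧ _ ∧ _) ↔ (_ ∧ p.upCount (i + 1 + 1) = _ ∧ _)
  rcases Nat.lt_or_ge (i + 1) (2 * p.semilength) with h' | h'
  · have h3 := upCount_nest_add_succ p q (i := i + 2) h'
    change _ = p.upCount (i + 1 + 1) + 1 at h3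
    rw [show i + 1 + 2 = i + 2 + 1 by ring, h1, h2, h3]
    omega
  -- Here `i` is the last step of `p`, necessarily a down step, so neither side holds.
  · have h3 := p.le_two_mul_upCount h.le
    have h4 := p.upCount_le (i + 1)
    rw [h1, h2]
    omega

theorem isPeak_nest_add_add (t i : ℕ) :
    (p.nest + q).IsPeak t (2 * p.semilength + 2 + i) ↔ q.IsPeak t i := by
  unfold IsPeak
  simp only [add_assoc (2 * p.semilength + 2), upCount_nest_add_add]
  omega

theorem isPeak_nest_add_zero (t : ℕ) :
    (p.nest + q).IsPeak (t + 1) 0 ↔ p = 0 ∧ t = 0 := by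
  have h1 := upCount_nest_add_succ p q (Nat.zero_le _)
  rw [upCount_zero] at h1
  unfold IsPeak
  rw [upCount_zero, h1]
  by_cases hp : p = 0
  · subst hp
    have h2 := upCount_nest_add_add 0 q 0
    rw [upCount_zero] at h2
    simp only [semilength_zero, Nat.mul_zero, Nat.zero_add, Nat.add_zero, true_and] at h2 ⊢
    rw [h2]
    omega
  · have hpos : 0 < p.semilength := by
      have := two_mul_semilength_eq_length (p := p)
      have := List.length_pos_iff.2 (toList_ne_nil.2 hp)
      omega
    have h2 := upCount_nest_add_succ p q (i := 1) (by omega)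
    have h3 := p.le_two_mul_upCount (i := 1) (by omega)
    simp only [hp, Nat.zero_add, Nat.reduceAdd, false_and, iff_false] at h2 ⊢
    rw [h2]
    omega

theorem not_isPeak_nest_add_return (t : ℕ) :
    ¬ (p.nest + q).IsPeak t (2 * p.semilength + 1) := by
  have h1 := upCount_nest_add_succ p q le_rfl
  have h2 := upCount_nest_add_add p q 0
  rw [upCount_of_le _ le_rfl] at h1
  rw [upCount_zero] at h2
  rintro ⟨h, -⟩
  simp only [Nat.add_zero] at h2
  rw [h1, h2] at h
  omega

/-- Nesting raises `p` by one, so its threshold drops to `t`, while `q` stays at ground level. The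
only new peak is that of `UD`, of height one, when `p` is empty. -/
theorem card_peaks_nest_add (t : ℕ) : ((p.nest + q).peaks (t + 1)).card =
    (if p = 0 ∧ t = 0 then 1 else 0) + (p.peaks t).card + (q.peaks (t + 1)).card := by
  simp only [card_peaks_eq_sum, semilength_add, semilength_nest]
  rw [show 2 * (p.semilength + 1 + q.semilength) =
    ((2 * p.semilength + 1) + 1) + 2 * q.semilength by ring, Finset.sum_range_add,
    Finset.sum_range_succ, Finset.sum_range_succ', if_neg (not_isPeak_nest_add_return p q _),
    add_zero]
  simp only [isPeak_nest_add_zero, isPeak_nest_add_add p q]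
  have h : ∀ i ∈ Finset.range (2 * p.semilength),
      (if (p.nest + q).IsPeak (t + 1) (i + 1) then 1 else 0) = if p.IsPeak t i then 1 else 0 :=
    fun i hi => if_congr (isPeak_nest_add_succ p q t (Finset.mem_range.1 hi)) rfl rfl
  rw [Finset.sum_congr rfl h, add_comm (∑ i ∈ _, _) (ite _ _ _)]

end NestAdd

theorem peaks_zero_eq_peaks_one (w : DyckWord) : w.peaks 0 = w.peaks 1 := by
  refine Finset.filter_congr fun i hi => ?_
  have := w.le_two_mul_upCount (Finset.mem_range.1 hi).le
  unfold IsPeak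
  omega

theorem card_peaks_zero (t : ℕ) : (peaks t 0).card = 0 := by simp [peaks]

/-! ### Recurrences for the signed counts -/

open BinaryTree Finset in
/-- The signed enumerator of the Dyck words of semilength `n` by peaks of height at least `t`. -/
def signedPeakCount (t n : ℕ) : ℤ :=
  ∑ T ∈ treesOfNumNodesEq n, (-1) ^ ((ofTree T).peaks t).card

open BinaryTree Finset in
theorem sum_treesOfNumNodesEq_succ {M : Type*} [AddCommMonoid M] (f : BinaryTree Unit → M)
    (n : ℕ) : ∑ T ∈ treesOfNumNodesEq (n + 1), f T = ∑ ij ∈ antidiagonal n,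
      ∑ l ∈ treesOfNumNodesEq ij.1, ∑ r ∈ treesOfNumNodesEq ij.2, f (.node () l r) := by
  rw [treesOfNumNodesEq_succ, sum_biUnion]
  · refine sum_congr rfl fun ij _ => ?_
    rw [sum_map, sum_product]
    rfl
  · simp_rw [Set.PairwiseDisjoint, Set.Pairwise, disjoint_left]
    aesop

theorem signedPeakCount_zero (t : ℕ) : signedPeakCount t 0 = 1 := by
  simp [signedPeakCount, ofTree, card_peaks_zero]

open Finset in
theorem signedPeakCount_two_succ (n : ℕ) : signedPeakCount 2 (n + 1) =
    ∑ ij ∈ antidiagonal n, signedPeakCount 1 ij.1 * signedPeakCount 2 ij.2 := by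
  rw [signedPeakCount, sum_treesOfNumNodesEq_succ]
  refine Finset.sum_congr rfl fun ij _ => ?_
  simp only [signedPeakCount, Finset.sum_mul_sum, ofTree, card_peaks_nest_add]
  simp [pow_add]

-- An empty first factor creates a peak of height one, which turns its contribution from `1` into
-- `-1`; hence the correction by `2`.
open Finset in
theorem signedPeakCount_one_succ (n : ℕ) : signedPeakCount 1 (n + 1) =
    ∑ ij ∈ antidiagonal n,
      (signedPeakCount 1 ij.1 - if ij.1 = 0 then 2 else 0) * signedPeakCount 1 ij.2 := by
  rw [signedPeakCount, sum_treesOfNumNodesEq_succ]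
  refine Finset.sum_congr rfl fun ij _ => ?_
  have h : signedPeakCount 1 ij.1 - (if ij.1 = 0 then 2 else 0) =
      ∑ l ∈ BinaryTree.treesOfNumNodesEq ij.1,
        (-1) ^ ((if ofTree l = 0 then 1 else 0) + ((ofTree l).peaks 1).card) := by
    split_ifs with h
    · rw [h, signedPeakCount_zero]
      simp [ofTree, card_peaks_zero]
    · rw [sub_zero, signedPeakCount]
      refine Finset.sum_congr rfl fun l hl => ?_
      rw [if_neg, zero_add]
      intro h0
      have := numNodes_toTree (ofTree l)
      rw [toTree_ofTree, BinaryTree.mem_treesOfNumNodesEq.1 hl, h0] at this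
      exact h this
  rw [h, signedPeakCount, Finset.sum_mul_sum]
  simp only [ofTree, card_peaks_nest_add, peaks_zero_eq_peaks_one]
  simp [pow_add]

/-! ### Solving for the generating functions -/

open PowerSeries

/-- The series `C(-X²)`, where `C` is the Catalan series. -/
noncomputable def signedCatalanSeries : ℤ⟦X⟧ :=
  expand 2 two_ne_zero (rescale (-1) (map (Nat.castRingHom ℤ) catalanSeries))

theorem signedCatalanSeries_eq :
    signedCatalanSeries = 1 - X ^ 2 * signedCatalanSeries ^ 2 := by
  have h := congrArg (fun f => expand 2 two_ne_zero
    (rescale (-1 : ℤ) (map (Nat.castRingHom ℤ) f))) catalanSeries_sq_mul_X_add_one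
  simp only [map_add, map_mul, map_pow, map_one, map_X, rescale_X, expand_X, expand_C] at h
  rw [← signedCatalanSeries, map_neg, map_one] at h
  linear_combination -h

theorem coeff_signedCatalanSeries_two_mul (m : ℕ) :
    coeff (2 * m) signedCatalanSeries = (-1) ^ m * (catalan m : ℤ) := by
  rw [signedCatalanSeries, coeff_expand_mul, coeff_rescale, coeff_map, catalanSeries_coeff]
  rfl

theorem coeff_signedCatalanSeries_of_odd {k : ℕ} (h : Odd k) :
    coeff k signedCatalanSeries = 0 := by
  rw [signedCatalanSeries, coeff_expand_of_not_dvd]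
  exact fun hd => Nat.not_even_iff_odd.2 h (even_iff_two_dvd.2 hd)

theorem mk_signedPeakCount_two : (PowerSeries.mk (signedPeakCount 2)) =
    1 + X * (PowerSeries.mk (signedPeakCount 1) * PowerSeries.mk (signedPeakCount 2)) := by
  ext n
  cases n with
  | zero => simp [signedPeakCount_zero]
  | succ n =>
    rw [coeff_mk, map_add, coeff_one, if_neg n.succ_ne_zero, zero_add, coeff_succ_X_mul, coeff_mul,
      signedPeakCount_two_succ]
    simp only [coeff_mk]

theorem mk_signedPeakCount_one : (PowerSeries.mk (signedPeakCount 1)) =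
    1 + X * ((PowerSeries.mk (signedPeakCount 1) - C 2) * PowerSeries.mk (signedPeakCount 1)) := by
  ext n
  cases n with
  | zero => simp [signedPeakCount_zero]
  | succ n =>
    rw [coeff_mk, map_add, coeff_one, if_neg n.succ_ne_zero, zero_add, coeff_succ_X_mul, coeff_mul,
      signedPeakCount_one_succ]
    simp only [coeff_mk, map_sub, coeff_C]

theorem mk_signedPeakCount_one_eq :
    PowerSeries.mk (signedPeakCount 1) = 1 - X * signedCatalanSeries := by
  have hP := mk_signedPeakCount_one
  have hD := signedCatalanSeries_eq
  have h2 : (C 2 : ℤ⟦X⟧) = 2 := by simp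
  rw [h2] at hP
  set P := PowerSeries.mk (signedPeakCount 1)
  set D := signedCatalanSeries
  -- `1 - X * D` satisfies the same quadratic equation as `P`; the difference of the two equations
  -- factors, and the second factor has constant term `1`.
  have h : (P - (1 - X * D)) * (1 - X * (P - 1 - X * D)) = 0 := by
    linear_combination hP + X * hD
  rcases mul_eq_zero.1 h with h | h
  · exact sub_eq_zero.1 h
  · have := congrArg constantCoeff h
    simp at this

theorem mk_signedPeakCount_two_eq :
    PowerSeries.mk (signedPeakCount 2) = 1 + X * signedCatalanSeries := by
  have hH := mk_signedPeakCount_two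
  have hD := signedCatalanSeries_eq
  rw [mk_signedPeakCount_one_eq] at hH
  set H := PowerSeries.mk (signedPeakCount 2)
  set D := signedCatalanSeries
  -- `1 + X * D` is the inverse of `1 - X * (1 - X * D)`.
  linear_combination (1 + X * D) * hH - X * H * hD

theorem signedPeakCount_two_of_even {n : ℕ} (hn : 1 ≤ n) (h : Even n) :
    signedPeakCount 2 n = 0 := by
  obtain ⟨k, rfl⟩ := Nat.exists_eq_add_of_le' hn
  have := congrArg (coeff (k + 1)) mk_signedPeakCount_two_eq
  rw [coeff_mk, map_add, coeff_succ_X_mul, coeff_one, if_neg k.succ_ne_zero, zero_add,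
    coeff_signedCatalanSeries_of_odd] at this
  · exact this
  · rw [← Nat.not_even_iff_odd]
    intro hk
    exact (Nat.even_add_one.1 h) hk

theorem signedPeakCount_two_of_odd (m : ℕ) :
    signedPeakCount 2 (2 * m + 1) = (-1) ^ m * (catalan m : ℤ) := by
  have := congrArg (coeff (2 * m + 1)) mk_signedPeakCount_two_eq
  rwa [coeff_mk, map_add, coeff_succ_X_mul, coeff_one, if_neg (2 * m).succ_ne_zero, zero_add,
    coeff_signedCatalanSeries_two_mul] at this

end DyckWord

/-! ### The canonical join complex of a finite lattice with canonical join representations -/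

section CanonicalJoin

variable {L : Type*} [Lattice L]

theorem IsCanonicalJoinRep.eq_of_le {A : Finset L} {a x y : L} (h : IsCanonicalJoinRep A a)
    (hx : x ∈ A) (hy : y ∈ A) (hxy : x ≤ y) : x = y := by
  classical
  by_contra hne
  refine h.irredundant (A.erase x) (Finset.erase_ssubset hx)
    ⟨fun z hz => h.isJoinRep.2.1 (Finset.mem_of_mem_erase hz), fun u hu =>
      h.isJoinRep.2.2 fun z hz => ?_⟩
  by_cases hzx : z = x
  · exact hzx ▸ hxy.trans (hu (Finset.mem_coe.2 (Finset.mem_erase.2 ⟨Ne.symm hne, hy⟩)))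
  · exact hu (Finset.mem_coe.2 (Finset.mem_erase.2 ⟨hzx, hz⟩))

theorem IsCanonicalJoinRep.unique {A B : Finset L} {a : L} (hA : IsCanonicalJoinRep A a)
    (hB : IsCanonicalJoinRep B a) : A = B := by
  have key : ∀ {A B : Finset L}, IsCanonicalJoinRep A a → IsCanonicalJoinRep B a → A ⊆ B := by
    intro A B hA hB x hx
    obtain ⟨y, hy, hxy⟩ := hA.refines B hB.isJoinRep x hx
    obtain ⟨z, hz, hyz⟩ := hB.refines A hA.isJoinRep y hy
    have := hA.eq_of_le hx hz (hxy.trans hyz)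
    rwa [hxy.antisymm (this ▸ hyz)]
  exact (key hA hB).antisymm (key hB hA)

/-- If every element of a finite lattice has a canonical join representation, the reduced Euler
characteristic of the canonical join complex is a signed count of the elements. -/
theorem reducedEulerCharacteristic_canonicalJoinComplex [Fintype L] {b : L} (hb : IsBot b)
    {A : L → Finset L} (hA : ∀ a, IsCanonicalJoinRep (A a) a) :
    (canonicalJoinComplex L).reducedEulerCharacteristic = -∑ a, (-1) ^ (A a).card := by
  classical
  have hinj : Function.Injective A := fun a c h =>
    (hA a).isJoinRep.2.unique (h ▸ (hA c).isJoinRep.2)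
  have hface : ∀ i, (canonicalJoinComplex L).faceCount i =
      (Finset.univ.filter fun a => (A a).card = i + 1).card := by
    intro i
    rw [PreAbstractSimplicialComplex.faceCount, ← Finset.card_image_of_injective _ hinj,
      ← Set.ncard_coe_finset]
    congr 1
    ext s
    simp only [Set.mem_ofPred_eq, Finset.coe_image, Finset.coe_filter, Finset.mem_univ, true_and,
      Set.mem_image]
    constructor
    · rintro ⟨⟨-, a, ha⟩, hs⟩
      have h := ha.unique (hA a)
      exact ⟨a, h ▸ hs, h.symm⟩
    · rintro ⟨a, ha, rfl⟩
      exact ⟨⟨Finset.card_pos.1 (by omega), a, hA a⟩, ha⟩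
  -- The bottom element alone has the empty representation; it accounts for the `-1` in the reduced
  -- Euler characteristic.
  have hbot : (Finset.univ.filter fun a => (A a).card = 0) = {b} := by
    ext a
    simp only [Finset.mem_filter, Finset.mem_univ, true_and, Finset.mem_singleton,
      Finset.card_eq_zero]
    constructor
    · intro h
      have := (hA a).isJoinRep.2
      rw [h, Finset.coe_empty, isLUB_empty_iff] at this
      exact (this b).antisymm (hb a)
    · rintro rfl
      refine Finset.eq_empty_of_forall_notMem fun x hx => ?_
      have hxa : x ≤ a := (hA a).isJoinRep.2.1 hx
      exact ((hA a).isJoinRep.1 x hx).1 fun y _ => hxa.trans (hb y)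
  have hsum : ∑ a, (-1 : ℤ) ^ (A a).card = ∑ k ∈ Finset.range (Fintype.card L + 1),
      (-1) ^ k * ((Finset.univ.filter fun a => (A a).card = k).card : ℤ) := by
    rw [← Finset.sum_fiberwise_of_maps_to (t := Finset.range (Fintype.card L + 1))
      (g := fun a => (A a).card) fun a _ =>
        Finset.mem_range.2 (Nat.lt_succ_of_le (Finset.card_le_univ _))]
    refine Finset.sum_congr rfl fun k _ => ?_
    rw [Finset.sum_congr rfl fun a ha => by rw [(Finset.mem_filter.1 ha).2], Finset.sum_const,
      nsmul_eq_mul, mul_comm]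
  rw [hsum, Finset.sum_range_succ', hbot, PreAbstractSimplicialComplex.reducedEulerCharacteristic,
    PreAbstractSimplicialComplex.eulerCharacteristic, Nat.card_eq_fintype_card]
  simp only [hface, pow_succ, Finset.card_singleton, mul_neg, mul_one, neg_mul,
    Finset.sum_neg_distrib]
  push_cast
  ring

end CanonicalJoin

/-! ### Canonical join representations in the Dyck lattice -/

namespace DyckPath

variable {n : ℕ}

theorem ups_mono (p : DyckPath n) : Monotone p.ups :=
  monotone_nat_of_le_succ fun i => by have := p.ups_succ i; omega

theorem ups_le (p : DyckPath n) (i : ℕ) : p.ups i ≤ n :=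
  (p.1.upCount_le i).trans_eq p.2

theorem ups_add_le (p : DyckPath n) (i d : ℕ) : p.ups (i + d) ≤ p.ups i + d := by
  induction d with
  | zero => rfl
  | succ d ih => have := p.ups_succ (i + d); rw [← add_assoc]; omega

theorem sup_ups (p q : DyckPath n) (i : ℕ) : (p ⊔ q).ups i = max (p.ups i) (q.ups i) :=
  (exists_sup p q).choose_spec i

instance : Nonempty (DyckPath n) := by
  obtain ⟨p, -⟩ := exists_ups_eq (n := n) (fun i => min i n) (by simp) (fun i => by omega)
    (fun i hi => by omega) (fun i hi => by omega)
  exact ⟨p⟩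

theorem exists_least_through (p : DyckPath n) (i : ℕ) :
    ∃ r : DyckPath n, p.ups i ≤ r.ups i ∧ ∀ q : DyckPath n, p.ups i ≤ q.ups i → r ≤ q := by
  have hi : p.ups i ≤ i := by
    have := p.ups_add_le 0 i
    rw [ups_zero] at this
    simpa using this
  have hn := p.ups_le i
  obtain ⟨r, hr⟩ := exists_ups_eq (n := n)
    -- The upper envelope of the lowest path, with `⌈k / 2⌉` up steps, and the path that climbs
    -- straight to the required point and then only descends; truncated subtraction makes `i - k`
    -- vanish for `k ≥ i`.
    (fun k => min n (max ((k + 1) / 2) (p.ups i - (i - k)))) (by simp; omega)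
    (fun k => by omega) (fun k hk => by omega) (fun k hk => by omega)
  refine ⟨r, by rw [hr]; omega, fun q hq k => ?_⟩
  rw [hr]
  have h1 : k ≤ 2 * n → k ≤ 2 * q.ups k := q.le_two_mul_ups
  have h2 : 2 * n ≤ k → q.ups k = n := q.ups_of_le
  rcases le_total i k with h | h
  · have := q.ups_mono h
    omega
  · have := q.ups_add_le k (i - k)
    rw [Nat.add_sub_cancel' h] at this
    omega

/-- The least Dyck path which is weakly above `p` after `i` steps. -/
noncomputable def leastThrough (p : DyckPath n) (i : ℕ) : DyckPath n :=
  (exists_least_through p i).choose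

theorem le_ups_leastThrough (p : DyckPath n) (i : ℕ) : p.ups i ≤ (p.leastThrough i).ups i :=
  (exists_least_through p i).choose_spec.1

theorem leastThrough_le_iff {p q : DyckPath n} {i : ℕ} :
    p.leastThrough i ≤ q ↔ p.ups i ≤ q.ups i :=
  ⟨fun h => (p.le_ups_leastThrough i).trans (h i), (exists_least_through p i).choose_spec.2 q⟩

/-- By `leastThrough_le_iff`, a join lies above this path only if one of the joinands does. Height
at least two at `i` keeps it off the bottom path, whose height never exceeds one. -/
theorem supIrred_leastThrough {p : DyckPath n} {i : ℕ}
    (h : i + 2 ≤ 2 * p.ups i) : SupIrred (p.leastThrough i) := by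
  refine ⟨fun hmin => ?_, fun q r hqr => ?_⟩
  · obtain ⟨b, hb⟩ := exists_ups_eq (n := n) (fun k => min n ((k + 1) / 2)) (by simp)
      (fun k => by omega) (fun k _ => by omega) (fun k hk => by omega)
    have hle : b ≤ p.leastThrough i := fun k => by
      have h1 : k ≤ 2 * n → k ≤ 2 * (p.leastThrough i).ups k := (p.leastThrough i).le_two_mul_ups
      have h2 : 2 * n ≤ k → (p.leastThrough i).ups k = n := (p.leastThrough i).ups_of_le
      rw [hb]
      omega
    have := leastThrough_le_iff.1 (hmin hle)
    rw [hb] at this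
    omega
  · have h1 := p.le_ups_leastThrough i
    rw [← hqr, sup_ups] at h1
    rcases le_max_iff.1 h1 with h1 | h1
    · exact Or.inl (le_antisymm (hqr ▸ le_sup_left) (leastThrough_le_iff.2 h1))
    · exact Or.inr (le_antisymm (hqr ▸ le_sup_right) (leastThrough_le_iff.2 h1))

theorem mem_peaks_two {p : DyckPath n} {i : ℕ} : i ∈ p.1.peaks 2 ↔ i < 2 * n ∧
    p.ups (i + 1) = p.ups i + 1 ∧ p.ups (i + 2) = p.ups (i + 1) ∧
      i + 1 + 2 ≤ 2 * p.ups (i + 1) := by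
  rw [DyckWord.peaks, p.2, Finset.mem_filter, Finset.mem_range]
  rfl

/-- Flipping a peak of height at least two gives a lower cover. -/
theorem exists_flip_peak {p : DyckPath n} {i : ℕ} (hi : i ∈ p.1.peaks 2) :
    ∃ q : DyckPath n, q.ups (i + 1) < p.ups (i + 1) ∧ (∀ k, k ≠ i + 1 → q.ups k = p.ups k) ∧
      ∀ r ≤ p, r.ups (i + 1) < p.ups (i + 1) → r ≤ q := by
  obtain ⟨hin, h1, h2, h3⟩ := mem_peaks_two.1 hi
  obtain ⟨q, hq⟩ := exists_ups_eq (n := n) (fun k => if k = i + 1 then p.ups i else p.ups k)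
    (by simp [ups_zero])
    (fun k => by
      have := p.ups_succ k
      by_cases hk : k = i
      · subst hk; simp
      · by_cases hk' : k = i + 1
        · subst hk'
          simp only [Nat.add_eq_left, one_ne_zero, if_true, if_false]
          change p.ups (i + 2) = _ ∨ p.ups (i + 2) = _
          omega
        · simpa [hk, hk'] using this)
    (fun k hk => by
      have := p.ups_of_le hk
      split_ifs with h
      · subst h
        omega
      · exact this)
    (fun k hk => by
      have := p.le_two_mul_ups hk
      split_ifs with h
      · omega
      · exact this)
  refine ⟨q, ?_, fun k hk => by rw [hq, if_neg hk], fun r hr hlt k => ?_⟩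
  · rw [hq, if_pos rfl]
    omega
  · rw [hq]
    split_ifs with h
    · subst h
      omega
    · exact hr k

/-- Where `u` runs strictly below `p`, take a highest point of `p`. A neighbouring point of `p` that
is higher would also lie strictly above `u`, so the point is an apex; by parity its height is at
least two. -/
theorem le_of_forall_peaks {p u : DyckPath n}
    (h : ∀ i ∈ p.1.peaks 2, p.ups (i + 1) ≤ u.ups (i + 1)) : p ≤ u := by
  by_contra hpu
  rw [le_def] at hpu
  push Not at hpu
  have hlt : ∀ k, u.ups k < p.ups k → k < 2 * n ∧ k + 2 ≤ 2 * p.ups k := by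
    intro k hk
    rcases Nat.lt_or_ge k (2 * n) with hkn | hkn
    · have := u.le_two_mul_ups hkn.le
      omega
    · rw [u.ups_of_le hkn, p.ups_of_le hkn] at hk
      omega
  obtain ⟨k, hk, hmax⟩ := Finset.exists_max_image
    ((Finset.range (2 * n)).filter fun k => u.ups k < p.ups k)
    (fun k => 2 * (p.ups k : ℤ) - k) (by
      obtain ⟨k, hk⟩ := hpu
      exact ⟨k, Finset.mem_filter.2 ⟨Finset.mem_range.2 (hlt k hk).1, hk⟩⟩)
  replace hk := (Finset.mem_filter.1 hk).2
  replace hmax : ∀ j, u.ups j < p.ups j → 2 * (p.ups j : ℤ) - j ≤ 2 * (p.ups k : ℤ) - k :=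
    fun j hj => hmax j (Finset.mem_filter.2 ⟨Finset.mem_range.2 (hlt j hj).1, hj⟩)
  obtain ⟨i, rfl⟩ : ∃ i, k = i + 1 := by
    refine Nat.exists_eq_succ_of_ne_zero ?_
    rintro rfl
    simp [ups_zero] at hk
  have hprev := hmax i
  have hnext := hmax (i + 2)
  have hp := p.ups_succ i
  have hp' : p.ups (i + 2) = _ ∨ p.ups (i + 2) = _ := p.ups_succ (i + 1)
  have hu := u.ups_succ i
  have hu' : u.ups (i + 2) = _ ∨ u.ups (i + 2) = _ := u.ups_succ (i + 1)
  have hk' := hlt _ hk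
  push_cast at hprev hnext
  have := h i (mem_peaks_two.2 ⟨by omega, by omega, by omega, by omega⟩)
  omega

open Classical in
/-- The canonical joinands of `p`. -/
noncomputable def canonicalJoinands (p : DyckPath n) : Finset (DyckPath n) :=
  (p.1.peaks 2).image fun i => p.leastThrough (i + 1)

theorem leastThrough_le_self (p : DyckPath n) (i : ℕ) : p.leastThrough i ≤ p :=
  leastThrough_le_iff.2 le_rfl

theorem eq_of_leastThrough_le {p : DyckPath n} {i j : ℕ} (hi : i ∈ p.1.peaks 2)
    (h : p.leastThrough (i + 1) ≤ p.leastThrough (j + 1)) : i = j := by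
  by_contra hne
  -- Flipping peak `i` leaves the apex at `j + 1` untouched, so the least path through that apex
  -- stays below the flip and misses the apex at `i + 1`.
  obtain ⟨q, hlt, hq, -⟩ := exists_flip_peak hi
  exact hlt.not_ge (leastThrough_le_iff.1 (h.trans (leastThrough_le_iff.2
    (hq (j + 1) (by omega)).ge)))

theorem isCanonicalJoinRep_canonicalJoinands (p : DyckPath n) :
    IsCanonicalJoinRep p.canonicalJoinands p := by
  classical
  -- If all of `B` missed the apex, the flipped path would be an upper bound of `B` not above `p`.
  -- This yields both irredundance and refinement.
  have hex : ∀ (B : Finset (DyckPath n)), IsLUB (B : Set (DyckPath n)) p →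
      ∀ i ∈ p.1.peaks 2, ∃ y ∈ B, p.leastThrough (i + 1) ≤ y := by
    intro B hB i hi
    obtain ⟨q, hlt, -, hq⟩ := exists_flip_peak hi
    by_contra! hcon
    exact hlt.not_ge (hB.2 (fun y hy => hq y (hB.1 hy)
      (not_le.1 fun hle => hcon y hy (leastThrough_le_iff.2 hle))) (i + 1))
  refine ⟨⟨fun j hj => ?_, ⟨fun x hx => ?_, fun u hu => le_of_forall_peaks fun i hi => ?_⟩⟩,
    fun B hBA hB => ?_, fun B hB x hx => ?_⟩
  · obtain ⟨i, hi, rfl⟩ := Finset.mem_image.1 hj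
    exact supIrred_leastThrough (mem_peaks_two.1 hi).2.2.2
  · obtain ⟨i, -, rfl⟩ := Finset.mem_image.1 (Finset.mem_coe.1 hx)
    exact p.leastThrough_le_self _
  · exact leastThrough_le_iff.1 (hu (Finset.mem_coe.2 (Finset.mem_image_of_mem _ hi)))
  · refine hBA.2 fun x hx => ?_
    obtain ⟨i, hi, rfl⟩ := Finset.mem_image.1 hx
    obtain ⟨y, hy, hle⟩ := hex B hB i hi
    obtain ⟨j, -, rfl⟩ := Finset.mem_image.1 (hBA.1 hy)
    rwa [eq_of_leastThrough_le hi hle]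
  · obtain ⟨i, hi, rfl⟩ := Finset.mem_image.1 hx
    exact hex B hB.2 i hi

theorem card_canonicalJoinands (p : DyckPath n) :
    p.canonicalJoinands.card = (p.1.peaks 2).card := by
  classical
  exact Finset.card_image_of_injOn fun _ hi _ _ h => eq_of_leastThrough_le hi (le_of_eq h)

instance : Fintype (DyckPath n) :=
  inferInstanceAs (Fintype {p : DyckWord // p.semilength = n})

theorem sum_neg_one_pow_card_peaks (n t : ℕ) :
    ∑ p : DyckPath n, (-1 : ℤ) ^ (p.1.peaks t).card = DyckWord.signedPeakCount t n := by
  rw [DyckWord.signedPeakCount, ← Finset.sum_coe_sort (BinaryTree.treesOfNumNodesEq n)]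
  refine Fintype.sum_equiv (DyckWord.equivTreesOfNumNodesEq n) _ _ fun p => ?_
  change _ = (-1) ^ ((DyckWord.ofTree p.1.toTree).peaks t).card
  rw [DyckWord.ofTree_toTree]

theorem reducedEulerCharacteristic_eq (n : ℕ) :
    (canonicalJoinComplex (DyckPath n)).reducedEulerCharacteristic =
      -DyckWord.signedPeakCount 2 n := by
  -- Passing through the origin is no constraint, so this least path is the bottom.
  have hb : IsBot ((Classical.arbitrary (DyckPath n)).leastThrough 0) := fun q =>
    leastThrough_le_iff.2 (by simp [ups_zero])
  rw [reducedEulerCharacteristic_canonicalJoinComplex hb isCanonicalJoinRep_canonicalJoinands]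
  simp only [card_canonicalJoinands, sum_neg_one_pow_card_peaks]

end DyckPath

theorem mainTheorem10 (n : ℕ) (hn : 1 ≤ n) :
    (Even n → (canonicalJoinComplex (DyckPath n)).reducedEulerCharacteristic = 0) ∧
    (∀ m : ℕ, n = 2 * m + 1 →
      (canonicalJoinComplex (DyckPath n)).reducedEulerCharacteristic =
        (-1) ^ (m + 1) * (catalan m : ℤ)) := by
  rw [DyckPath.reducedEulerCharacteristic_eq]
  refine ⟨fun h => ?_, ?_⟩
  · rw [DyckWord.signedPeakCount_two_of_even hn h, neg_zero]
  · rintro m rfl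
    rw [DyckWord.signedPeakCount_two_of_odd, pow_succ]
    ring
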